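/- Let $\mathbb F$ be an algebraically closed field of characteristic zero. Let $\mathbb A(2,-1,0)$ be the associative unital $\mathbb F$-algebra with generators $A,B,C$ and relations $$BA^2=2ABA-A^2B,\quad B^2A=2BAB-AB^2,\quad CB^2=2BCB-B^2C,$$ $$C^2B=2CBC-BC^2,\quad AC^2=2CAC-C^2A,\quad A^2C=2ACA-CA^2.$$ Let $\mathcal C=\begin{pmatrix}2&-1&-1\\-1&2&-1\\-1&-1&2\end{pmatrix}$, and let $A_2^{(1)}$ be the (derived) Kac-Moody Lie algebra over $\mathbb F$ with generators $e_i,f_i,h_i$ $(1\le i\le 3)$ and relations, for $1\le i,j\le 3$, $$[h_i,h_j]=0,\quad [h_i,e_j]=\mathcal C_{i,j}e_j,\quad [h_i,f_j]=-\mathcal C_{i,j}f_j,\quad [e_i,f_j]=\delta_{i,j}h_i,$$ $$[e_i,[e_i,e_j]]=0,\quad [f_i,[f_i,f_j]]=0\qquad(i\ne j).$$ Let $U(A_2^{(1)})$ be its universal enveloping algebra. Then there exists an $\mathbb F$-algebra homomorphism $\mathbb A(2,-1,0)\to U(A_2^{(1)})$ that sends $A\mapsto e_1$, $B\mapsto e_2$,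 $C\mapsto e_3$ (where $e_i$ also denotes the image of $e_i$ in $U(A_2^{(1)})$), and this homomorphism is injective. -/

import Mathlib

noncomputable section

namespace Z3DownUp

universe u

/-- The names of the three standard generators. -/
inductive Gen
  | A
  | B
  | C

section Relations

variable (F : Type u) [Field F]

/-- The free associative unital algebra on the letters `A`, `B`, `C`. -/
abbrev FreeABC : Type u := FreeAlgebra F Gen

/-- The letter `A` of the free algebra. -/
abbrev a : FreeABC F := FreeAlgebra.ι F Gen.A

/-- The letter `B` of the free algebra. -/
abbrev b : FreeABC F := FreeAlgebra.ι F Gen.B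

/-- The letter `C` of the free algebra. -/
abbrev c : FreeABC F := FreeAlgebra.ι F Gen.C

/-- The six `ℤ₃`-symmetric down-up relations with parameters `α`, `β`, `γ`. -/
inductive Rel (α β γ : F) : FreeABC F → FreeABC F → Prop
  | ba : Rel α β γ (b F * a F ^ 2)
      (α • (a F * b F * a F) + β • (a F ^ 2 * b F) + γ • a F)
  | bba : Rel α β γ (b F ^ 2 * a F)
      (α • (b F * a F * b F) + β • (a F * b F ^ 2) + γ • b F)
  | cb : Rel α β γ (c F * b F ^ 2)
      (α • (b F * c F * b F) + β • (b F ^ 2 * c F) + γ • b F)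
  | ccb : Rel α β γ (c F ^ 2 * b F)
      (α • (c F * b F * c F) + β • (b F * c F ^ 2) + γ • c F)
  | ac : Rel α β γ (a F * c F ^ 2)
      (α • (c F * a F * c F) + β • (c F ^ 2 * a F) + γ • c F)
  | aac : Rel α β γ (a F ^ 2 * c F)
      (α • (a F * c F * a F) + β • (c F * a F ^ 2) + γ • a F)

end Relations

/-- The `ℤ₃`-symmetric down-up algebra `𝔸(α, β, γ)`: the associative unital `F`-algebra with
generators `A`, `B`, `C` and the six `ℤ₃`-symmetric down-up relations. -/
abbrev DownUp {F : Type u} [Field F] (α β γ : F) : Type u := RingQuot (Rel F α β γ)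

/-- The standard generators of `𝔸(α, β, γ)`. -/
def gen {F : Type u} [Field F] (α β γ : F) (x : Gen) : DownUp α β γ :=
  RingQuot.mkAlgHom F (Rel F α β γ) (FreeAlgebra.ι F x)

end Z3DownUp

namespace KacMoodyA2

universe u

/-- The Cartan matrix of type `A₂⁽¹⁾`. -/
def cartan : Matrix (Fin 3) (Fin 3) ℤ :=
  !![2, -1, -1; -1, 2, -1; -1, -1, 2]

/-- The (derived) Kac-Moody Lie algebra `A₂⁽¹⁾`: Mathlib's Lie algebra with generators
`eᵢ, fᵢ, hᵢ` and the relations `[hᵢ, hⱼ] = 0`, `[hᵢ, eⱼ] = Cᵢⱼ eⱼ`, `[hᵢ, fⱼ] = -Cᵢⱼ fⱼ`,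
`[eᵢ, fⱼ] = δᵢⱼ hᵢ` and `(ad eᵢ)^(1 - Cᵢⱼ) eⱼ = 0 = (ad fᵢ)^(1 - Cᵢⱼ) fⱼ` for `i ≠ j`.
Every off-diagonal entry of the matrix is `-1`, so the last two families read
`[eᵢ, [eᵢ, eⱼ]] = 0 = [fᵢ, [fᵢ, fⱼ]]`. -/
abbrev LieAlg (F : Type u) [Field F] : Type u := Matrix.ToLieAlgebra F cartan

/-- The generator `eᵢ₊₁` of `A₂⁽¹⁾` (the index set `Fin 3` starts at `0`). -/
def e (F : Type u) [Field F] (i : Fin 3) : LieAlg F :=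
  (LieSubmodule.Quotient.mk (FreeLieAlgebra.of F (CartanMatrix.Generators.E i)) :
    FreeLieAlgebra F (CartanMatrix.Generators (Fin 3)) ⧸
      CartanMatrix.Relations.toIdeal F cartan)

end KacMoodyA2

end

/-! The algebra `𝔸(2, -1, 0)` is presented by the Serre relations, so the homomorphism exists. For
injectivity, the algebra itself becomes a lowest weight module: `eᵢ` acts by left multiplication,
while `hᵢ` and `fᵢ` kill `1` and have the commutators with the `eⱼ` that the Lie algebra dictates.
Evaluating the action at `1` is then a left inverse, so no triangular decomposition or PBW theorem
is needed. Such operators exist by the universal property applied to dual numbers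
(`exists_op_of_lie`), and they are unique (`eq_zero_of_lie_opE`); uniqueness yields the remaining
relations. -/

noncomputable section

attribute [local instance] LieRing.ofAssociativeRing LieAlgebra.ofAssociativeAlgebra

namespace Z3DownUp

universe u

variable (F : Type u) [Field F]

/-- The position of a generator in the cyclic order `A`, `B`, `C`. -/
def Gen.index : Gen → Fin 3
  | Gen.A => 0
  | Gen.B => 1
  | Gen.C => 2

/-- The generator at a given position in the cyclic order `A`, `B`, `C`. -/
def genAt : Fin 3 → Gen := ![Gen.A, Gen.B, Gen.C]

theorem genAt_index (x : Gen) : genAt x.index = x := by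
  cases x <;> rfl

theorem index_genAt (i : Fin 3) : (genAt i).index = i := by
  fin_cases i <;> rfl

/-- The algebra `𝔸(2, -1, 0)`, whose relations are the Serre relations of type `A₂⁽¹⁾`. -/
abbrev Serre : Type u := DownUp (2 : F) (-1) 0

/-- The generators of `𝔸(2, -1, 0)`, indexed by `Fin 3`. -/
def serreGen (i : Fin 3) : Serre F := gen 2 (-1) 0 (genAt i)

variable {F}

/-! ### The Serre presentation -/

theorem lie_lie_eq {R : Type*} [Ring R] (x y : R) :
    ⁅x, ⁅x, y⁆⁆ = x ^ 2 * y - 2 * (x * y * x) + y * x ^ 2 := by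
  simp only [Ring.lie_def]
  noncomm_ring

/-- The universal property of `𝔸(2, -1, 0)`. -/
theorem exists_algHom_of_serre {R : Type*} [Ring R] [Algebra F R] (X : Fin 3 → R)
    (hX : ∀ i j, i ≠ j → ⁅X i, ⁅X i, X j⁆⁆ = 0) :
    ∃ φ : Serre F →ₐ[F] R, ∀ i, φ (serreGen F i) = X i := by
  have key : ∀ i j, i ≠ j → X i ^ 2 * X j - 2 * (X i * X j * X i) + X j * X i ^ 2 = 0 :=
    fun i j h => lie_lie_eq (X i) (X j) ▸ hX i j h
  have w : ∀ ⦃x y⦄, Rel F 2 (-1) 0 x y →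
      FreeAlgebra.lift F (fun g : Gen => X g.index) x =
        FreeAlgebra.lift F (fun g : Gen => X g.index) y := by
    intro x y h
    have h01 := key 0 1 (by decide)
    have h10 := key 1 0 (by decide)
    have h12 := key 1 2 (by decide)
    have h21 := key 2 1 (by decide)
    have h20 := key 2 0 (by decide)
    have h02 := key 0 2 (by decide)
    cases h <;>
      simp only [map_mul, map_pow, map_add, map_neg, FreeAlgebra.lift_ι_apply, Gen.index,
        neg_smul, one_smul, zero_smul, add_zero, two_smul] <;>
      rw [← sub_eq_zero]
    · rw [← h01]; noncomm_ring
    · rw [← h10]; noncomm_ring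
    · rw [← h12]; noncomm_ring
    · rw [← h21]; noncomm_ring
    · rw [← h20]; noncomm_ring
    · rw [← h02]; noncomm_ring
  refine ⟨RingQuot.liftAlgHom F ⟨_, w⟩, fun i => ?_⟩
  simp [serreGen, gen, RingQuot.liftAlgHom_mkAlgHom_apply, index_genAt]

theorem serreGen_lie_lie {i j : Fin 3} (h : i ≠ j) :
    ⁅serreGen F i, ⁅serreGen F i, serreGen F j⁆⁆ = 0 := by
  have rel : ∀ {x y}, Rel F 2 (-1) 0 x y → RingQuot.mkAlgHom F (Rel F 2 (-1) 0) x =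
      RingQuot.mkAlgHom F (Rel F 2 (-1) 0) y := fun h => RingQuot.mkAlgHom_rel F h
  have h01 := rel Rel.ba
  have h10 := rel Rel.bba
  have h12 := rel Rel.cb
  have h21 := rel Rel.ccb
  have h20 := rel Rel.ac
  have h02 := rel Rel.aac
  simp only [map_mul, map_pow, map_add, map_neg, neg_smul, one_smul, zero_smul, add_zero,
    two_smul] at h01 h10 h12 h21 h20 h02
  rw [lie_lie_eq]
  fin_cases i <;> fin_cases j <;> first | exact absurd rfl h | skip
  all_goals simp [serreGen, gen, genAt]
  · rw [h01]; noncomm_ring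
  · rw [add_comm, ← sub_eq_zero.mpr h02]; noncomm_ring
  · rw [h10]; noncomm_ring
  · rw [h12]; noncomm_ring
  · rw [h20]; noncomm_ring
  · rw [h21]; noncomm_ring

theorem serre_induction {p : Serre F → Prop} (one : p 1)
    (add : ∀ x y, p x → p y → p (x + y)) (smul : ∀ (r : F) x, p x → p (r • x))
    (mul : ∀ i x, p x → p (serreGen F i * x)) (x : Serre F) : p x := by
  suffices h : ∀ (t : FreeAlgebra F Gen) (y : Serre F), p y →
      p (RingQuot.mkAlgHom F (Rel F 2 (-1) 0) t * y) by
    obtain ⟨t, rfl⟩ := RingQuot.mkAlgHom_surjective F (Rel F 2 (-1) 0) x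
    simpa using h t 1 one
  intro t
  induction t using FreeAlgebra.induction with
  | grade0 r =>
    intro y hy
    rw [AlgHom.commutes, ← Algebra.smul_def]
    exact smul r y hy
  | grade1 g =>
    intro y hy
    have := mul g.index y hy
    rwa [serreGen, genAt_index] at this
  | mul s t hs ht =>
    intro y hy
    rw [map_mul, mul_assoc]
    exact hs _ (ht _ hy)
  | add s t hs ht =>
    intro y hy
    rw [map_add, add_mul]
    exact add _ _ (hs _ hy) (ht _ hy)

/-! ### Operators determined by commutators with left multiplications -/

variable (F) in
/-- Left multiplication by a generator of `𝔸(2, -1, 0)`. -/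
def opE (i : Fin 3) : Module.End F (Serre F) := LinearMap.mulLeft F (serreGen F i)

theorem opE_lie_lie {i j : Fin 3} (h : i ≠ j) : ⁅opE F i, ⁅opE F i, opE F j⁆⁆ = 0 := by
  ext x
  have := congrArg (· * x) (serreGen_lie_lie (F := F) h)
  simpa [Ring.lie_def, opE, sub_mul, mul_sub, mul_assoc] using this

/-- An operator commuting with left multiplications is right multiplication by its value at `1`. -/
theorem eq_zero_of_lie_opE {T : Module.End F (Serre F)} (hT : ∀ k, ⁅T, opE F k⁆ = 0)
    (h1 : T 1 = 0) : T = 0 := by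
  ext x
  induction x using serre_induction with
  | one => simpa using h1
  | add x y hx hy => simp_all
  | smul r x hx => simp_all
  | mul i x hx =>
    have := LinearMap.congr_fun (hT i) x
    rw [Ring.lie_def] at this
    simp only [LinearMap.sub_apply, Module.End.mul_apply, opE, LinearMap.mulLeft_apply,
      LinearMap.zero_apply, hx, mul_zero, sub_zero] at this
    simpa using this

theorem snd_lie_lie {R : Type*} [Ring R] (x y : DualNumber R) :
    (⁅x, ⁅x, y⁆⁆).snd = ⁅x.snd, ⁅x.fst, y.fst⁆⁆ + ⁅x.fst, ⁅x.snd, y.fst⁆⁆ +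
      ⁅x.fst, ⁅x.fst, y.snd⁆⁆ := by
  simp only [Ring.lie_def, TrivSqZeroExt.snd_sub, TrivSqZeroExt.snd_mul, TrivSqZeroExt.fst_sub,
    TrivSqZeroExt.fst_mul, smul_eq_mul, MulOpposite.smul_eq_mul_unop, MulOpposite.unop_op]
  noncomm_ring

theorem fst_lie_lie {R : Type*} [Ring R] (x y : DualNumber R) :
    (⁅x, ⁅x, y⁆⁆).fst = ⁅x.fst, ⁅x.fst, y.fst⁆⁆ := by
  simp only [Ring.lie_def, TrivSqZeroExt.fst_sub, TrivSqZeroExt.fst_mul]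

/-- Operators on `𝔸(2, -1, 0)` may be prescribed by their commutators with the generators, as long
as these satisfy the linearised Serre relations. -/
theorem exists_op_of_lie (δ : Fin 3 → Module.End F (Serre F))
    (hδ : ∀ i j, i ≠ j → ⁅δ i, ⁅opE F i, opE F j⁆⁆ + ⁅opE F i, ⁅δ i, opE F j⁆⁆ +
      ⁅opE F i, ⁅opE F i, δ j⁆⁆ = 0) :
    ∃ T : Module.End F (Serre F), T 1 = 0 ∧ ∀ i, ⁅T, opE F i⁆ = δ i := by
  -- The Serre relations for `eᵢ + ε δᵢ` split into those for `eᵢ` and their linearisation `hδ`.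
  let X : Fin 3 → DualNumber (Module.End F (Serre F)) :=
    fun i => (opE F i, δ i)
  obtain ⟨φ, hφ⟩ := exists_algHom_of_serre (F := F) X (by
    intro i j hij
    ext1
    · exact (fst_lie_lie _ _).trans (opE_lie_lie hij)
    · exact (snd_lie_lie _ _).trans (hδ i j hij))
  have hfst : ∀ x, (φ x).fst = Algebra.lmul F (Serre F) x := by
    intro x
    induction x using serre_induction with
    | one => rw [map_one, map_one, TrivSqZeroExt.fst_one]
    | add x y hx hy => simp [hx, hy]
    | smul r x hx => simp [hx]
    | mul i x hx =>
      rw [map_mul, map_mul, TrivSqZeroExt.fst_mul, hx, hφ]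
      rfl
  -- `T x` is the `ε`-part of `φ x` applied to `1`; the product rule gives `T (eᵢ x) = eᵢ (T x) + δᵢ
  -- x`.
  refine ⟨(LinearMap.applyₗ (1 : Serre F)).comp
    ((TrivSqZeroExt.sndHom _ _).restrictScalars F ∘ₗ φ.toLinearMap), by simp, fun i => ?_⟩
  ext x
  have h := congrArg (fun t => t.snd 1) (map_mul φ (serreGen F i) x)
  have hx : (φ x).fst 1 = x := by rw [hfst]; exact mul_one x
  simp only [TrivSqZeroExt.snd_mul, hφ, smul_eq_mul, MulOpposite.smul_eq_mul_unop,
    MulOpposite.unop_op, LinearMap.add_apply, Module.End.mul_apply, hx] at h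
  exact sub_eq_of_eq_add' h

/-- Infinitesimal form of the fact that rescaling generators preserves the homogeneous Serre
relations. -/
theorem lie_lie_smul_add {L : Type*} [LieRing L] {x y : L} (h : ⁅x, ⁅x, y⁆⁆ = 0) (m n : ℤ) :
    ⁅m • x, ⁅x, y⁆⁆ + ⁅x, ⁅m • x, y⁆⁆ + ⁅x, ⁅x, n • y⁆⁆ = 0 := by
  simp only [zsmul_lie, lie_zsmul, h, smul_zero, add_zero]

/-! ### The operators `hᵢ`, `fᵢ` and their relations -/

theorem exists_opH (i : Fin 3) : ∃ T : Module.End F (Serre F), T 1 = 0 ∧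
    ∀ j, ⁅T, opE F j⁆ = KacMoodyA2.cartan i j • opE F j := by
  exact exists_op_of_lie _ fun j k hjk => lie_lie_smul_add (opE_lie_lie hjk) _ _

variable (F) in
/-- The Cartan generator `hᵢ` acting on `𝔸(2, -1, 0)` by the weight grading. -/
def opH (i : Fin 3) : Module.End F (Serre F) := (exists_opH i).choose

theorem opH_one (i : Fin 3) : opH F i 1 = 0 := (exists_opH i).choose_spec.1

theorem opH_lie_opE (i j : Fin 3) : ⁅opH F i, opE F j⁆ = KacMoodyA2.cartan i j • opE F j :=
  (exists_opH i).choose_spec.2 j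

theorem cartan_self (i : Fin 3) : KacMoodyA2.cartan i i = 2 := by
  fin_cases i <;> rfl

theorem cartan_of_ne {i j : Fin 3} (h : i ≠ j) : KacMoodyA2.cartan i j = -1 := by
  revert h
  fin_cases i <;> fin_cases j <;> decide

theorem opH_lie_opE_lie_opE {i j : Fin 3} (h : i ≠ j) :
    ⁅opH F i, ⁅opE F i, opE F j⁆⁆ = ⁅opE F i, opE F j⁆ := by
  rw [leibniz_lie, opH_lie_opE, opH_lie_opE, cartan_self, cartan_of_ne h, zsmul_lie, lie_zsmul]
  module

theorem exists_opF (i : Fin 3) : ∃ T : Module.End F (Serre F), T 1 = 0 ∧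
    ∀ j, ⁅T, opE F j⁆ = if i = j then -opH F i else 0 := by
  refine exists_op_of_lie _ fun j k hjk => ?_
  -- If `i = j`, the weights of `[eᵢ, eₖ]` and `eₖ` under `hᵢ`, namely `1` and `-1`, cancel; if `i =
  -- k`, what remains is a multiple of `[eⱼ, eⱼ]`.
  by_cases hij : i = j
  · subst hij
    simp only [if_pos, if_neg hjk, neg_lie, lie_neg, opH_lie_opE_lie_opE hjk, opH_lie_opE,
      cartan_of_ne hjk, lie_zsmul, lie_zero]
    module
  · by_cases hik : i = k
    · subst hik
      have : ⁅opE F j, opH F i⁆ = opE F j := by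
        rw [← lie_skew, opH_lie_opE, cartan_of_ne hij]
        module
      simp [hij, this]
    · simp [hij, hik]

variable (F) in
/-- The lowering operator `fᵢ` on `𝔸(2, -1, 0)`. -/
def opF (i : Fin 3) : Module.End F (Serre F) := (exists_opF i).choose

theorem opF_one (i : Fin 3) : opF F i 1 = 0 := (exists_opF i).choose_spec.1

theorem opF_lie_opE (i j : Fin 3) : ⁅opF F i, opE F j⁆ = if i = j then -opH F i else 0 :=
  (exists_opF i).choose_spec.2 j

theorem opH_lie_opH (i j : Fin 3) : ⁅opH F i, opH F j⁆ = 0 := by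
  refine eq_zero_of_lie_opE (fun k => ?_) (by simp [Ring.lie_def, opH_one])
  rw [lie_lie, opH_lie_opE, opH_lie_opE, lie_zsmul, lie_zsmul, opH_lie_opE, opH_lie_opE]
  module

theorem opH_lie_opF (i j : Fin 3) : ⁅opH F i, opF F j⁆ = -(KacMoodyA2.cartan i j • opF F j) := by
  rw [← sub_eq_zero, sub_neg_eq_add]
  refine eq_zero_of_lie_opE (fun k => ?_) (by simp [Ring.lie_def, opH_one, opF_one])
  rw [add_lie, lie_lie, zsmul_lie, opH_lie_opE, lie_zsmul, opF_lie_opE]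
  split_ifs with h
  · subst h
    rw [lie_neg, opH_lie_opH]
    module
  · simp

theorem opE_lie_opF (i j : Fin 3) : ⁅opE F i, opF F j⁆ = if i = j then opH F i else 0 := by
  rw [← lie_skew, opF_lie_opE]
  by_cases h : i = j
  · simp [h]
  · simp [h, Ne.symm h]

/-- By uniqueness, commuting with each `eₖ` suffices. For `k = i` the two Jacobi terms are `∓[fᵢ,
fⱼ]`; for `k = j` a multiple of `[fᵢ, fᵢ]` remains. -/
theorem opF_lie_lie {i j : Fin 3} (hij : i ≠ j) : ⁅opF F i, ⁅opF F i, opF F j⁆⁆ = 0 := by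
  have hHF : ∀ i j, ⁅opF F j, opH F i⁆ = KacMoodyA2.cartan i j • opF F j := fun i j => by
    rw [← lie_skew, opH_lie_opF, neg_neg]
  refine eq_zero_of_lie_opE (fun k => ?_) (by simp [Ring.lie_def, opF_one])
  rw [lie_lie, lie_lie (opF F i) (opF F j)]
  simp only [opF_lie_opE]
  by_cases hik : i = k
  · subst hik
    simp only [if_pos, if_neg hij.symm, lie_neg, lie_zero, hHF, cartan_of_ne hij, zero_sub,
      neg_neg, lie_zsmul, ← lie_skew _ (opH F i)]
    rw [leibniz_lie, opH_lie_opF, opH_lie_opF, cartan_self, cartan_of_ne hij, neg_lie, zsmul_lie,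
      lie_neg, lie_zsmul]
    module
  · by_cases hjk : j = k
    · subst hjk
      simp [hik, hHF, cartan_of_ne hij.symm]
    · simp [hik, hjk]

end Z3DownUp

/-! ### The Kac-Moody action -/

namespace KacMoodyA2

universe u

variable {F : Type u} [Field F]

open CartanMatrix Z3DownUp

variable (F) in
/-- The action of the generators of the Kac-Moody algebra on `𝔸(2, -1, 0)`. -/
def genAction : Generators (Fin 3) → Module.End F (Serre F)
  | .H i => opH F i
  | .E i => opE F i
  | .F i => opF F i

theorem lift_genAction_eq_zero {x : FreeLieAlgebra F (Generators (Fin 3))}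
    (hx : x ∈ Relations.toIdeal F cartan) : FreeLieAlgebra.lift F (genAction F) x = 0 := by
  suffices h : Relations.toIdeal F cartan ≤ (FreeLieAlgebra.lift F (genAction F)).ker from
    LieHom.mem_ker.mp (h hx)
  refine LieSubmodule.lieSpan_le.mpr ?_
  rintro _ (((((⟨⟨i, j⟩, rfl⟩ | ⟨⟨i, j⟩, rfl⟩) | ⟨⟨i, j⟩, rfl⟩) | ⟨⟨i, j⟩, rfl⟩) |
    ⟨⟨i, j⟩, rfl⟩) | ⟨⟨i, j⟩, rfl⟩) <;> rw [SetLike.mem_coe, LieHom.mem_ker]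
  · simp [Relations.HH, genAction, opH_lie_opH]
  · by_cases h : i = j <;> simp [Relations.EF, genAction, opE_lie_opF, h]
  · simp [Relations.HE, genAction, opH_lie_opE]
  · simp [Relations.HF, genAction, opH_lie_opF]
  -- On the diagonal the exponent `(-2).toNat` is `0`, so the relation is just `[eᵢ, eᵢ] = 0`.
  · by_cases h : i = j
    · simp [Relations.adE, h, cartan_self]
    · simp [Relations.adE, cartan_of_ne h, genAction, opE_lie_lie h]
  · by_cases h : i = j
    · simp [Relations.adF, h, cartan_self]
    · simp [Relations.adF, cartan_of_ne h, genAction, opF_lie_lie h]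

/-- The Kac-Moody algebra acts on `𝔸(2, -1, 0)`, with `eᵢ` acting by left multiplication. -/
theorem exists_action : ∃ ρ : LieAlg F →ₗ⁅F⁆ Module.End F (Serre F), ∀ i, ρ (e F i) = opE F i := by
  let l := Submodule.liftQ (Relations.toIdeal F cartan).toSubmodule
    (FreeLieAlgebra.lift F (genAction F) : _ →ₗ[F] Module.End F (Serre F))
    fun x hx => LinearMap.mem_ker.mpr (lift_genAction_eq_zero hx)
  let ρ : (FreeLieAlgebra F (Generators (Fin 3)) ⧸ Relations.toIdeal F cartan) →ₗ⁅F⁆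
      Module.End F (Serre F) :=
    { l with
      map_lie' := by
        intro x y
        obtain ⟨x, rfl⟩ := LieSubmodule.Quotient.surjective_mk' _ x
        obtain ⟨y, rfl⟩ := LieSubmodule.Quotient.surjective_mk' _ y
        exact LieHom.map_lie (FreeLieAlgebra.lift F (genAction F)) x y }
  exact ⟨ρ, fun i => FreeLieAlgebra.lift_of_apply (genAction F) (Generators.E i)⟩

theorem e_lie_lie {i j : Fin 3} (h : i ≠ j) : ⁅e F i, ⁅e F i, e F j⁆⁆ = 0 := by
  have hmem : Relations.adE F cartan (i, j) ∈ Relations.toIdeal F cartan :=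
    LieSubmodule.subset_lieSpan (.inl (.inr ⟨(i, j), rfl⟩))
  have h1 : (-cartan i j).toNat = 1 := by rw [cartan_of_ne h]; rfl
  have := LieSubmodule.Quotient.mk_eq_zero'.mpr hmem
  simp only [Relations.adE, Function.uncurry, h1, pow_one, Function.comp] at this
  exact this

theorem ι_e_lie_lie {i j : Fin 3} (h : i ≠ j) :
    ⁅UniversalEnvelopingAlgebra.ι F (e F i), ⁅UniversalEnvelopingAlgebra.ι F (e F i),
      UniversalEnvelopingAlgebra.ι F (e F j)⁆⁆ = 0 := by
  rw [← LieHom.map_lie, ← LieHom.map_lie, e_lie_lie h, map_zero]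

end KacMoodyA2

end

theorem mainTheorem8 (F : Type*) [Field F] [IsAlgClosed F] [CharZero F] :
    ∃ φ : Z3DownUp.DownUp (2 : F) (-1) 0 →ₐ[F]
        UniversalEnvelopingAlgebra F (KacMoodyA2.LieAlg F),
      φ (Z3DownUp.gen 2 (-1) 0 Z3DownUp.Gen.A) =
          UniversalEnvelopingAlgebra.ι F (KacMoodyA2.e F 0) ∧
      φ (Z3DownUp.gen 2 (-1) 0 Z3DownUp.Gen.B) =
          UniversalEnvelopingAlgebra.ι F (KacMoodyA2.e F 1) ∧
      φ (Z3DownUp.gen 2 (-1) 0 Z3DownUp.Gen.C) =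
          UniversalEnvelopingAlgebra.ι F (KacMoodyA2.e F 2) ∧
      Function.Injective φ := by
  obtain ⟨φ, hφ⟩ := Z3DownUp.exists_algHom_of_serre (F := F)
    (fun i => UniversalEnvelopingAlgebra.ι F (KacMoodyA2.e F i))
    fun _ _ h => KacMoodyA2.ι_e_lie_lie h
  refine ⟨φ, hφ 0, hφ 1, hφ 2, ?_⟩
  obtain ⟨ρ, hρ⟩ := KacMoodyA2.exists_action (F := F)
  have key : ∀ x, UniversalEnvelopingAlgebra.lift F ρ (φ x) 1 = x := by
    intro x
    induction x using Z3DownUp.serre_induction with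
    | one => simp
    | add x y hx hy => simp [hx, hy]
    | smul r x hx => simp [hx]
    | mul i x hx =>
      rw [map_mul, map_mul, hφ, UniversalEnvelopingAlgebra.lift_ι_apply, hρ,
        Module.End.mul_apply, hx]
      rfl
  intro x y hxy
  rw [← key x, hxy, key]
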